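/- For a function $\phi:\mathbb{R}\to\mathbb{R}$ and $d\ge 1$, let $\mathcal{S}_{d}(\phi)$ be the set of functions on $\mathbb{R}^{d}$ represented by a shallow $\phi$ network, i.e. of the form $$F(x)=\sum_{i=1}^{k}t_i\,\phi(\langle y_i,x\rangle+\varrho_i),\qquad k\in\mathbb{N},\ t_i,\varrho_i\in\mathbb{R},\ y_i\in\mathbb{R}^{d}.$$ Null sets are meant with respect to Lebesgue measure, and "monotone" means non-decreasing or non-increasing. **Theorem 3.5.** Let $n\in\mathbb{N}$, $\Omega=\mathbb{R}\times[0,1]^n\subset\mathbb{R}^{n+1}$ and $2\le p<\infty$. Let $\phi:\mathbb{R}\to\mathbb{R}$ be a (Lebesgue) measurable function such that 1. $\phi$ is essentially bounded, i.e. bounded outside some null set; 2. $\phi$ is eventually essentially monotone, i.e. there are $X>0$ and null sets $Z_1,Z_2\subset\mathbb{R}$ such that $\phi$ is monotone on $(X,\infty)\setminus Z_1$ and monotone on $(-\infty,-X)\setminus Z_2$ (the two directions of monotonicity may differ); 3. $\phi$ has different a.e. limits at $+\infty$ and $-\infty$, i.e. there are real numbers $a\ne b$ and null sets $Z_+,Z_-\subset\mathbb{R}$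 such that $\phi(t)\to a$ as $t\to+\infty$, $t\notin Z_+$, and $\phi(t)\to b$ as $t\to-\infty$, $t\notin Z_-$. Then the shallow $\phi$ networks are dense in the real space $L^p(\Omega)$ (with Lebesgue measure): $$\overline{\mathcal{S}_{n+1}(\phi)\cap L^{p}(\Omega)}=L^{p}(\Omega),$$ where $\mathcal{S}_{n+1}(\phi)\cap L^{p}(\Omega)$ is the set of elements of $L^p(\Omega)$ that agree almost everywhere on $\Omega$ with some $F\in\mathcal{S}_{n+1}(\phi)$, and the closure is taken in the $L^p(\Omega)$ norm. -/

import Mathlib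

open MeasureTheory Filter Topology
open scoped ENNReal

namespace ShallowNet

/-- `φ` is bounded on `s`. -/
def IsBoundedOn (φ : ℝ → ℝ) (s : Set ℝ) : Prop :=
  ∃ C : ℝ, ∀ x ∈ s, |φ x| ≤ C

/-- `φ` is monotone on `s`, that is, non-decreasing on `s` or non-increasing on `s`. -/
def IsMonotoneOn (φ : ℝ → ℝ) (s : Set ℝ) : Prop :=
  MonotoneOn φ s ∨ AntitoneOn φ s

/-- `φ`, restricted to `U`, is essentially `P`: it is `P` on `U \ Z` for some Lebesgue null
set `Z`. -/
def EssentiallyOn (P : (ℝ → ℝ) → Set ℝ → Prop) (φ : ℝ → ℝ) (U : Set ℝ) : Prop :=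
  ∃ Z : Set ℝ, volume Z = 0 ∧ P φ (U \ Z)

/-- `φ` is eventually essentially `P`: for some `X > 0` it is essentially `P` on `(X, ∞)` and
on `(-∞, -X)`. -/
def EventuallyEssentially (P : (ℝ → ℝ) → Set ℝ → Prop) (φ : ℝ → ℝ) : Prop :=
  ∃ X : ℝ, 0 < X ∧ EssentiallyOn P φ (Set.Ioi X) ∧ EssentiallyOn P φ (Set.Iio (-X))

/-- `φ` tends to `c` along `l` almost everywhere: for some Lebesgue null set `Z`, `φ t` tends
to `c` along `l` with `t ∉ Z`. -/
def HasAELimit (φ : ℝ → ℝ) (l : Filter ℝ) (c : ℝ) : Prop :=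
  ∃ Z : Set ℝ, volume Z = 0 ∧ Tendsto φ (l ⊓ 𝓟 Zᶜ) (𝓝 c)

/-- The neuron `x ↦ φ (⟨y, x⟩ + ϱ)` on `ℝ^d`. -/
noncomputable def neuron {d : ℕ} (φ : ℝ → ℝ) (ϱ : ℝ) (y : EuclideanSpace ℝ (Fin d)) :
    EuclideanSpace ℝ (Fin d) → ℝ :=
  fun x => φ (inner ℝ y x + ϱ)

/-- The set of all functions on `ℝ^d` that are represented by a shallow `φ` network. -/
def shallowNetworks (d : ℕ) (φ : ℝ → ℝ) : Set (EuclideanSpace ℝ (Fin d) → ℝ) :=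
  {F | ∃ (k : ℕ) (y : Fin k → EuclideanSpace ℝ (Fin d)) (t ϱ : Fin k → ℝ),
    F = fun x => ∑ i, t i * neuron φ (ϱ i) (y i) x}

/-- The elements of `L^p(Ω)` (real-valued, with respect to Lebesgue measure on `Ω`) that are
represented by a shallow `φ` network. -/
def networksInLp {d : ℕ} (φ : ℝ → ℝ) (Ω : Set (EuclideanSpace ℝ (Fin d))) (p : ℝ≥0∞) :
    Set (Lp ℝ p (volume.restrict Ω)) :=
  {f | ∃ F ∈ shallowNetworks d φ, f =ᵐ[volume.restrict Ω] F}

/-- The shallow `φ` network is a universal approximator in `L^p(Ω)`: the closure, for the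
`L^p` norm, of the set of networks in `L^p(Ω)` is all of `L^p(Ω)`. -/
def IsUniversalApproximator {d : ℕ} (φ : ℝ → ℝ) (Ω : Set (EuclideanSpace ℝ (Fin d)))
    (p : ℝ≥0∞) [Fact (1 ≤ p)] : Prop :=
  closure (networksInLp φ Ω p) = Set.univ

/-- The set `ℝ × [0,1]^n` in `ℝ^(n+1)`. -/
def lineTimesCube (n : ℕ) : Set (EuclideanSpace ℝ (Fin (n + 1))) :=
  {x | ∀ i : Fin n, x i.succ ∈ Set.Icc (0 : ℝ) 1}

end ShallowNet

/-!
By monotone convergence a bounded monotone step `φ` satisfies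
`∫ (φ (t - c) - φ (t - d)) dt = (d - c) (φ(∞) - φ(-∞))`, which is what makes the dilated
differences `φ (r (t - c)) - φ (r (t - d))` converge in `L^1`, hence in every `L^p` with `p < ∞`,
to a multiple of the indicator of `(c, d]` as `r → ∞`. Whatever `φ` does on a bounded interval is
scaled away. So on the line the networks are dense.

The functionals `⟨v, ·⟩` with `v 0 = 1` map Lebesgue measure on `ℝ × [0,1]^n` to Lebesgue measure
on `ℝ`, so that all ridge functions `f ⟨v, x⟩` with `f` continuous of compact support are
approximable. Moving `v` in the direction of a cube coordinate and taking difference quotients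
yields `f' ⟨v, x⟩ xᵢ`; every `f` is an `L^p` limit of derivatives, because
`t ↦ f t - s f (s t)` has a compactly supported primitive and `‖s f (s ·)‖_p → 0` as `s → 0`
when `p > 1`. Iterating gives the products of `f (x 0)` with polynomials, which suffice by
the Stone–Weierstrass theorem.
-/

namespace ShallowNet

section Approximation

variable {α β : Type*} [MeasurableSpace α] [MeasurableSpace β]

/-- The functions in `L^p(μ)` that can be approximated, in the `L^p` seminorm, by elements of
the space `S` of functions. -/
def lpClosure (S : Submodule ℝ (α → ℝ)) (p : ℝ≥0∞) [hp : Fact (1 ≤ p)] (μ : Measure α) :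
    Submodule ℝ (α → ℝ) where
  carrier := {F | MemLp F p μ ∧
    ∀ ε : ℝ≥0∞, ε ≠ 0 → ∃ G ∈ S, MemLp G p μ ∧ eLpNorm (F - G) p μ ≤ ε}
  zero_mem' := ⟨MemLp.zero, fun ε _ => ⟨0, S.zero_mem, MemLp.zero, by simp⟩⟩
  add_mem' := by
    rintro F F' ⟨hF, h⟩ ⟨hF', h'⟩
    refine ⟨hF.add hF', fun ε hε => ?_⟩
    obtain ⟨G, hGS, hG, hGε⟩ := h (ε / 2) (by simpa using hε)
    obtain ⟨G', hGS', hG', hGε'⟩ := h' (ε / 2) (by simpa using hε)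
    refine ⟨G + G', S.add_mem hGS hGS', hG.add hG', ?_⟩
    rw [add_sub_add_comm]
    refine (eLpNorm_add_le (hF.sub hG).1 (hF'.sub hG').1 hp.out).trans ?_
    exact (add_le_add hGε hGε').trans (ENNReal.add_halves ε).le
  smul_mem' := by
    rintro c F ⟨hF, h⟩
    refine ⟨hF.const_smul c, fun ε hε => ?_⟩
    obtain ⟨G, hGS, hG, hGε⟩ := h (ε / ‖c‖ₑ) (by simp [hε])
    refine ⟨c • G, S.smul_mem c hGS, hG.const_smul c, ?_⟩
    rw [← smul_sub, eLpNorm_const_smul]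
    exact (mul_le_mul_right hGε _).trans ENNReal.mul_div_le

variable {S : Submodule ℝ (α → ℝ)} {p : ℝ≥0∞} [hp : Fact (1 ≤ p)] {μ : Measure α} {F : α → ℝ}

theorem mem_lpClosure_of_mem (hF : F ∈ S) (h : MemLp F p μ) : F ∈ lpClosure S p μ :=
  ⟨h, fun _ _ => ⟨F, hF, h, by simp⟩⟩

theorem mem_lpClosure_of_approx (hF : MemLp F p μ)
    (h : ∀ ε : ℝ≥0∞, ε ≠ 0 → ∃ G ∈ lpClosure S p μ, eLpNorm (F - G) p μ ≤ ε) :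
    F ∈ lpClosure S p μ := by
  refine ⟨hF, fun ε hε => ?_⟩
  obtain ⟨G, ⟨hG, hG'⟩, hGε⟩ := h (ε / 2) (by simpa using hε)
  obtain ⟨K, hKS, hK, hKε⟩ := hG' (ε / 2) (by simpa using hε)
  refine ⟨K, hKS, hK, ?_⟩
  rw [← sub_add_sub_cancel F G K]
  refine (eLpNorm_add_le (hF.sub hG).1 (hG.sub hK).1 hp.out).trans ?_
  exact (add_le_add hGε hKε).trans (ENNReal.add_halves ε).le

theorem mem_lpClosure_of_tendsto {ι : Type*} {l : Filter ι} [l.NeBot] {G : ι → α → ℝ}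
    (hF : MemLp F p μ) (hG : ∀ᶠ i in l, G i ∈ lpClosure S p μ)
    (h : Tendsto (fun i => eLpNorm (F - G i) p μ) l (𝓝 0)) : F ∈ lpClosure S p μ := by
  refine mem_lpClosure_of_approx hF fun ε hε => ?_
  obtain ⟨i, hi, hi'⟩ := (hG.and (h.eventually_le_const (pos_iff_ne_zero.2 hε))).exists
  exact ⟨G i, hi, hi'⟩

theorem comp_mem_lpClosure {ν : Measure β} {T : Submodule ℝ (β → ℝ)} {g : α → β}
    (hg : MeasurePreserving g μ ν) (hTS : ∀ G ∈ T, G ∘ g ∈ S) {f : β → ℝ}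
    (hf : f ∈ lpClosure T p ν) : f ∘ g ∈ lpClosure S p μ := by
  refine ⟨hf.1.comp_measurePreserving hg, fun ε hε => ?_⟩
  obtain ⟨G, hGT, hG, hGε⟩ := hf.2 ε hε
  refine ⟨G ∘ g, hTS G hGT, hG.comp_measurePreserving hg, ?_⟩
  have : f ∘ g - G ∘ g = (f - G) ∘ g := rfl
  rw [this, eLpNorm_comp_measurePreserving (hf.1.sub hG).1 hg]
  exact hGε

theorem eLpNorm_le_interpolate (hp' : p ≠ ∞) {C : ℝ≥0∞} (hCt : C ≠ ∞)
    (hC : ∀ᵐ x ∂μ, ‖F x‖ₑ ≤ C) :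
    eLpNorm F p μ ≤ (C ^ (p.toReal - 1) * ∫⁻ x, ‖F x‖ₑ ∂μ) ^ (1 / p.toReal) := by
  have h0 : p ≠ 0 := (zero_lt_one.trans_le hp.out).ne'
  have h1 : 1 ≤ p.toReal := by
    simpa using (ENNReal.toReal_le_toReal ENNReal.one_ne_top hp').2 hp.out
  rw [eLpNorm_eq_lintegral_rpow_enorm_toReal h0 hp']
  gcongr
  rw [← lintegral_const_mul' _ _ (by finiteness)]
  refine lintegral_mono_ae (hC.mono fun x hx => ?_)
  calc ‖F x‖ₑ ^ p.toReal = ‖F x‖ₑ ^ (p.toReal - 1) * ‖F x‖ₑ ^ (1 : ℝ) := by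
        rw [← ENNReal.rpow_add_of_nonneg _ _ (by linarith) zero_le_one, sub_add_cancel]
    _ ≤ C ^ (p.toReal - 1) * ‖F x‖ₑ := by
        rw [ENNReal.rpow_one]
        gcongr

theorem tendsto_eLpNorm_of_tendsto_lintegral (hp' : p ≠ ∞) {ι : Type*} {l : Filter ι}
    {E : ι → α → ℝ} {C : ℝ≥0∞} (hCt : C ≠ ∞) (hC : ∀ᶠ i in l, ∀ᵐ x ∂μ, ‖E i x‖ₑ ≤ C)
    (h : Tendsto (fun i => ∫⁻ x, ‖E i x‖ₑ ∂μ) l (𝓝 0)) :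
    Tendsto (fun i => eLpNorm (E i) p μ) l (𝓝 0) := by
  have h1 : 1 ≤ p.toReal := by
    simpa using (ENNReal.toReal_le_toReal ENNReal.one_ne_top hp').2 hp.out
  refine tendsto_of_tendsto_of_tendsto_of_le_of_le' tendsto_const_nhds ?_
    (Eventually.of_forall fun _ => zero_le) (hC.mono fun i => eLpNorm_le_interpolate hp' hCt)
  have h2 := ENNReal.Tendsto.const_mul (a := C ^ (p.toReal - 1)) h (Or.inr (by finiteness))
  have h3 := ((ENNReal.continuous_rpow_const (y := 1 / p.toReal)).tendsto _).comp h2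
  have h4 : 0 < p.toReal := by linarith
  simpa [h4, Function.comp_def] using h3

theorem mem_lpClosure_of_forall_le (hF : MemLp F p μ) {k : α → ℝ} (hk : MemLp k p μ)
    (h : ∀ δ : ℝ, 0 < δ → ∃ G ∈ lpClosure S p μ, ∀ᵐ x ∂μ, |F x - G x| ≤ δ * k x) :
    F ∈ lpClosure S p μ := by
  refine mem_lpClosure_of_approx hF fun ε hε => ?_
  have hlim : Tendsto (fun δ : ℝ => ENNReal.ofReal δ * eLpNorm k p μ) (𝓝[>] 0) (𝓝 0) := by
    have h1 : Tendsto (fun δ : ℝ => ENNReal.ofReal δ) (𝓝[>] 0) (𝓝 (ENNReal.ofReal 0)) :=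
      (ENNReal.continuous_ofReal.tendsto 0).mono_left nhdsWithin_le_nhds
    simpa using ENNReal.Tendsto.mul_const h1 (Or.inr hk.2.ne)
  obtain ⟨δ, hδ, hδ0⟩ := ((hlim.eventually_le_const (pos_iff_ne_zero.2 hε)).and
    self_mem_nhdsWithin).exists
  obtain ⟨G, hG, hGk⟩ := h δ hδ0
  refine ⟨G, hG, (eLpNorm_mono_ae_real (g := δ • k) ?_).trans ?_⟩
  · filter_upwards [hGk] with x hx using hx
  · rwa [eLpNorm_const_smul, Real.enorm_of_nonneg (le_of_lt hδ0)]

end Approximation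

section Dilation

variable {p : ℝ≥0∞} {f : ℝ → ℝ}

theorem eLpNorm_comp_mul_left (hp : p ≠ ∞) {r : ℝ} (hr : r ≠ 0) :
    eLpNorm (fun t => f (r * t)) p volume =
      ENNReal.ofReal |r⁻¹| ^ (1 / p).toReal * eLpNorm f p volume := by
  rw [← smul_eq_mul, ← eLpNorm_smul_measure_of_ne_top hp, ← Real.map_volume_mul_left hr,
    (measurableEmbedding_mulLeft₀ hr).eLpNorm_map_measure]
  rfl

theorem quasiMeasurePreserving_mul_sub {r : ℝ} (hr : r ≠ 0) (c : ℝ) :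
    Measure.QuasiMeasurePreserving (fun t : ℝ => r * (t - c)) volume volume := by
  have hmul : Measure.QuasiMeasurePreserving (fun t : ℝ => r * t) volume volume :=
    ⟨measurable_const_mul r, by
      rw [Real.map_volume_mul_left hr]
      exact Measure.smul_absolutelyContinuous⟩
  exact hmul.comp (measurePreserving_sub_right volume c).quasiMeasurePreserving

theorem tendsto_eLpNorm_comp_mul_sub (hp0 : p ≠ 0) (hp : p ≠ ∞) (hf : MemLp f p volume) (c : ℝ) :
    Tendsto (fun r => eLpNorm (fun t => f (r * (t - c))) p volume) atTop (𝓝 0) := by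
  have hscale : ∀ᶠ r : ℝ in atTop, ENNReal.ofReal r⁻¹ ^ (1 / p).toReal * eLpNorm f p volume =
      eLpNorm (fun t => f (r * (t - c))) p volume := by
    filter_upwards [eventually_gt_atTop 0] with r hr
    rw [← abs_of_pos (inv_pos.2 hr), ← eLpNorm_comp_mul_left hp hr.ne',
      ← eLpNorm_comp_measurePreserving _ (measurePreserving_sub_right volume c)]
    · rfl
    · simpa [Function.comp_def] using
        hf.1.comp_quasiMeasurePreserving (quasiMeasurePreserving_mul_sub hr.ne' 0)
  have hpos : 0 < (1 / p).toReal := ENNReal.toReal_pos (by simpa using hp) (by simpa using hp0)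
  have hzero : Tendsto (fun r : ℝ => ENNReal.ofReal r⁻¹ ^ (1 / p).toReal) atTop (𝓝 0) := by
    simpa only [ENNReal.ofReal_zero, ENNReal.zero_rpow_of_pos hpos] using
      (ENNReal.tendsto_ofReal tendsto_inv_atTop_zero).ennrpow_const (1 / p).toReal
  simpa using (ENNReal.Tendsto.mul_const hzero (Or.inr hf.2.ne)).congr' hscale

end Dilation

section Scheffe

variable {α ι : Type*} [MeasurableSpace α] {μ : Measure α} {l : Filter ι}

theorem tendsto_lintegral_enorm_sub_of_tendsto_integral [l.IsCountablyGenerated]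
    {f : ι → α → ℝ} {g : α → ℝ} (hf : ∀ᶠ i in l, Integrable (f i) μ)
    (hf0 : ∀ᶠ i in l, 0 ≤ᵐ[μ] f i) (hg : Integrable g μ)
    (hlim : ∀ᵐ x ∂μ, Tendsto (fun i => f i x) l (𝓝 (g x)))
    (hint : Tendsto (fun i => ∫ x, f i x ∂μ) l (𝓝 (∫ x, g x ∂μ))) :
    Tendsto (fun i => ∫⁻ x, ‖f i x - g x‖ₑ ∂μ) l (𝓝 0) := by
  have hneg : Tendsto (fun i => ∫ x, max (g x - f i x) 0 ∂μ) l (𝓝 0) := by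
    have hdom := tendsto_integral_filter_of_dominated_convergence (μ := μ) (l := l)
      (F := fun i x => max (g x - f i x) 0) (f := fun _ => 0) (fun x => |g x|)
      (hf.mono fun i hi => (hg.sub hi).pos_part.1)
      (hf0.mono fun i hi => hi.mono fun x hx => ?_) hg.abs
      (hlim.mono fun x hx => by simpa using (hx.const_sub (g x)).max (tendsto_const_nhds (x := 0)))
    · simpa using hdom
    · rw [Real.norm_of_nonneg (le_max_right _ _)]
      exact max_le ((sub_le_self _ hx).trans (le_abs_self _)) (abs_nonneg _)
  have hpos : Tendsto (fun i => ∫ x, (f i x - g x) ∂μ) l (𝓝 0) := by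
    simpa using (hint.sub_const (∫ x, g x ∂μ)).congr'
      (hf.mono fun i hi => (integral_sub hi hg).symm)
  -- `|x| = x + 2 x⁻`, and the negative part of `f i - g` is dominated by `|g|`.
  have habs : ∀ᶠ i in l, ∫ x, (f i x - g x) ∂μ + 2 * ∫ x, max (g x - f i x) 0 ∂μ =
      ∫ x, ‖f i x - g x‖ ∂μ := by
    filter_upwards [hf] with i hi
    rw [← integral_const_mul]
    refine (integral_add (hi.sub hg) ((hg.sub hi).pos_part.const_mul 2)).symm.trans ?_
    refine integral_congr_ae (Eventually.of_forall fun x => ?_)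
    rcases le_total (f i x) (g x) with h | h <;> simp [Real.norm_eq_abs, h, abs_of_nonneg,
      abs_of_nonpos]
    ring
  have hreal : Tendsto (fun i => ∫ x, ‖f i x - g x‖ ∂μ) l (𝓝 0) := by
    simpa using (hpos.add (hneg.const_mul 2)).congr' habs
  simpa using (ENNReal.tendsto_ofReal hreal).congr' (hf.mono fun i hi =>
    ofReal_integral_norm_eq_lintegral_enorm (hi.sub hg))

end Scheffe

section StepLimit

/-- The difference of the translates of `φ` by `c` and `d`, sharpened by dilations, converges in
`L^p` to `s` times the indicator function of the interval between `c` and `d`. For a sigmoidal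
function `s` is the difference of its limits at `+∞` and at `-∞`. -/
structure HasStepLimit (φ : ℝ → ℝ) (p : ℝ≥0∞) (s : ℝ) : Prop where
  aestronglyMeasurable : AEStronglyMeasurable φ volume
  tendsto : ∀ c d : ℝ, c < d → Tendsto (fun r : ℝ => eLpNorm (fun t => φ (r * (t - c)) -
    φ (r * (t - d)) - (Set.Ioc c d).indicator (fun _ => s) t) p volume) atTop (𝓝 0)

namespace HasStepLimit

variable {φ ψ : ℝ → ℝ} {p : ℝ≥0∞} {s s' : ℝ}

theorem aestronglyMeasurable_error (h : HasStepLimit φ p s) {r : ℝ} (hr : r ≠ 0) (c d : ℝ) :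
    AEStronglyMeasurable (fun t => φ (r * (t - c)) - φ (r * (t - d)) -
      (Set.Ioc c d).indicator (fun _ => s) t) volume :=
  ((h.1.comp_quasiMeasurePreserving (quasiMeasurePreserving_mul_sub hr c)).sub
    (h.1.comp_quasiMeasurePreserving (quasiMeasurePreserving_mul_sub hr d))).sub
    (aestronglyMeasurable_const.indicator measurableSet_Ioc)

theorem congr_ae (h : HasStepLimit φ p s) (hψ : φ =ᵐ[volume] ψ) : HasStepLimit ψ p s := by
  refine ⟨h.1.congr hψ, fun c d hcd => (h.2 c d hcd).congr' ?_⟩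
  filter_upwards [eventually_ne_atTop 0] with r hr
  exact eLpNorm_congr_ae ((((quasiMeasurePreserving_mul_sub hr c).ae_eq hψ).sub
    ((quasiMeasurePreserving_mul_sub hr d).ae_eq hψ)).sub EventuallyEq.rfl)

theorem add (hp : 1 ≤ p) (h : HasStepLimit φ p s) (h' : HasStepLimit ψ p s') :
    HasStepLimit (φ + ψ) p (s + s') := by
  refine ⟨h.1.add h'.1, fun c d hcd => ?_⟩
  refine tendsto_of_tendsto_of_tendsto_of_le_of_le' tendsto_const_nhds
    (by simpa using (h.2 c d hcd).add (h'.2 c d hcd)) (Eventually.of_forall fun _ => zero_le) ?_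
  filter_upwards [eventually_ne_atTop 0] with r hr
  refine le_of_eq_of_le (congrArg (eLpNorm · p volume) ?_) (eLpNorm_add_le
    (h.aestronglyMeasurable_error hr c d) (h'.aestronglyMeasurable_error hr c d) hp)
  ext t
  by_cases ht : t ∈ Set.Ioc c d <;> simp only [Pi.add_apply, Set.indicator, ht, if_true, if_false]
    <;> ring

theorem const_smul (h : HasStepLimit φ p s) (k : ℝ) : HasStepLimit (k • φ) p (k * s) := by
  refine ⟨h.1.const_smul k, fun c d hcd => ?_⟩
  have hk := ENNReal.Tendsto.const_mul (a := ‖k‖ₑ) (h.2 c d hcd) (Or.inr enorm_ne_top)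
  rw [mul_zero] at hk
  refine hk.congr fun r => ?_
  rw [← eLpNorm_const_smul]
  congr 1
  ext t
  by_cases ht : t ∈ Set.Ioc c d <;> simp [ht, mul_sub]

theorem comp_neg (h : HasStepLimit φ p s) : HasStepLimit (fun t => φ (-t)) p (-s) := by
  refine ⟨h.1.comp_measurePreserving (Measure.measurePreserving_neg volume), fun c d hcd => ?_⟩
  refine (h.2 (-d) (-c) (neg_lt_neg hcd)).congr' ?_
  filter_upwards [eventually_ne_atTop 0] with r hr
  rw [← eLpNorm_comp_measurePreserving (h.aestronglyMeasurable_error hr _ _)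
    (Measure.measurePreserving_neg volume), ← eLpNorm_neg]
  refine eLpNorm_congr_ae ?_
  filter_upwards [Measure.ae_ne volume c, Measure.ae_ne volume d] with t hc hd
  have hmem : -t ∈ Set.Ioc (-d) (-c) ↔ t ∈ Set.Ioc c d := by
    rw [Set.neg_mem_Ioc_iff, neg_neg, neg_neg, Set.mem_Ico, Set.mem_Ioc, hc.symm.le_iff_lt,
      hd.le_iff_lt]
  have hc' : r * (-t - -c) = -(r * (t - c)) := by ring
  have hd' : r * (-t - -d) = -(r * (t - d)) := by ring
  simp only [Pi.neg_apply, Function.comp_apply, Set.indicator, hmem, hc', hd']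
  split_ifs <;> ring

theorem of_memLp (hp1 : 1 ≤ p) (hp : p ≠ ∞) (hφ : MemLp φ p volume) : HasStepLimit φ p 0 := by
  refine ⟨hφ.1, fun c d _ => ?_⟩
  have hp0 : p ≠ 0 := (zero_lt_one.trans_le hp1).ne'
  have hlim := (tendsto_eLpNorm_comp_mul_sub hp0 hp hφ c).add
    (tendsto_eLpNorm_comp_mul_sub hp0 hp hφ d)
  rw [add_zero] at hlim
  refine tendsto_of_tendsto_of_tendsto_of_le_of_le' tendsto_const_nhds hlim
    (Eventually.of_forall fun _ => zero_le) ?_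
  filter_upwards [eventually_ne_atTop 0] with r hr
  simp only [Set.indicator_zero, sub_zero]
  exact eLpNorm_sub_le
    (hφ.1.comp_quasiMeasurePreserving (quasiMeasurePreserving_mul_sub hr c))
    (hφ.1.comp_quasiMeasurePreserving (quasiMeasurePreserving_mul_sub hr d)) hp1

end HasStepLimit

section MonotoneStep

variable {g : ℝ → ℝ} {A B : ℝ}

theorem tendsto_integral_sub_sub_of_monotone (hg : Monotone g) {l : Filter ℝ} {L : ℝ}
    (hlim : Tendsto g l (𝓝 L)) (hl : ∀ x : ℝ, Tendsto (fun T => T - x) l l) {c d : ℝ}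
    (hcd : c ≤ d) :
    Tendsto (fun T => ∫ t in T - d..T - c, g t) l (𝓝 ((d - c) * L)) := by
  have hle : ∀ T : ℝ, T - d ≤ T - c := fun T => by linarith
  have hint : ∀ T : ℝ, IntervalIntegrable g volume (T - d) (T - c) := fun _ =>
    hg.intervalIntegrable
  refine tendsto_of_tendsto_of_tendsto_of_le_of_le ((hlim.comp (hl d)).const_mul (d - c))
    ((hlim.comp (hl c)).const_mul (d - c)) (fun T => ?_) fun T => ?_
  · simpa using intervalIntegral.integral_mono_on (hle T) intervalIntegrable_const (hint T)
      fun t ht => hg ht.1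
  · simpa using intervalIntegral.integral_mono_on (hle T) (hint T) intervalIntegrable_const
      fun t ht => hg ht.2

theorem integrable_and_integral_sub_of_monotone (hg : Monotone g)
    (hA : Tendsto g atBot (𝓝 A)) (hB : Tendsto g atTop (𝓝 B)) {c d : ℝ} (hcd : c ≤ d) :
    Integrable (fun t => g (t - c) - g (t - d)) volume ∧
      ∫ t, (g (t - c) - g (t - d)) = (d - c) * (B - A) := by
  have hmono : ∀ x : ℝ, Monotone fun t => g (t - x) := fun x s t hst => hg (by linarith)
  have hnonneg : ∀ t, 0 ≤ g (t - c) - g (t - d) := fun t => sub_nonneg.2 (hg (by linarith))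
  have hcover := aecover_Ioc (μ := volume) (tendsto_neg_atTop_atBot (G := ℝ)) tendsto_id
  have hint : ∀ T : ℝ, IntegrableOn (fun t => g (t - c) - g (t - d)) (Set.Ioc (-T) (id T)) :=
    fun T => (hmono c).locallyIntegrable.sub (hmono d).locallyIntegrable
      |>.integrableOn_isCompact isCompact_Icc |>.mono_set Set.Ioc_subset_Icc_self
  have hlim : Tendsto (fun T : ℝ => ∫ t in Set.Ioc (-T) (id T), (g (t - c) - g (t - d))) atTop
      (𝓝 ((d - c) * (B - A))) := by
    have hends := (tendsto_integral_sub_sub_of_monotone hg hB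
      (fun x => tendsto_atTop_add_const_right _ (-x) tendsto_id) hcd).sub
      ((tendsto_integral_sub_sub_of_monotone hg hA
        (fun x => tendsto_atBot_add_const_right _ (-x) tendsto_id) hcd).comp
        tendsto_neg_atTop_atBot)
    rw [← mul_sub] at hends
    refine hends.congr' ?_
    filter_upwards [eventually_ge_atTop 0] with T hT
    rw [id, ← intervalIntegral.integral_of_le (by linarith), intervalIntegral.integral_sub
      (hmono c).intervalIntegrable (hmono d).intervalIntegrable,
      intervalIntegral.integral_comp_sub_right, intervalIntegral.integral_comp_sub_right,
      intervalIntegral.integral_interval_sub_interval_comm' hg.intervalIntegrable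
        hg.intervalIntegrable hg.intervalIntegrable]
    rfl
  exact ⟨hcover.integrable_of_integral_tendsto_of_nonneg_ae _ hint (ae_of_all _ hnonneg) hlim,
    hcover.integral_eq_of_tendsto_of_nonneg_ae _ (ae_of_all _ hnonneg) hint hlim⟩

theorem tendsto_sub_comp_mul_sub (hA : Tendsto g atBot (𝓝 A)) (hB : Tendsto g atTop (𝓝 B))
    {c d t : ℝ} (hcd : c < d) (hc : t ≠ c) (hd : t ≠ d) :
    Tendsto (fun r : ℝ => g (r * (t - c)) - g (r * (t - d))) atTop
      (𝓝 ((Set.Ioc c d).indicator (fun _ => B - A) t)) := by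
  have hleft : ∀ {x : ℝ}, t < x → Tendsto (fun r : ℝ => g (r * (t - x))) atTop (𝓝 A) :=
    fun h => hA.comp (tendsto_id.atTop_mul_const_of_neg (sub_neg.2 h))
  have hright : ∀ {x : ℝ}, x < t → Tendsto (fun r : ℝ => g (r * (t - x))) atTop (𝓝 B) :=
    fun h => hB.comp (tendsto_id.atTop_mul_const (sub_pos.2 h))
  rcases hc.lt_or_gt with htc | htc
  · rw [Set.indicator_of_notMem (fun h => htc.not_gt h.1), ← sub_self A]
    exact (hleft htc).sub (hleft (htc.trans hcd))
  rcases hd.lt_or_gt with htd | htd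
  · rw [Set.indicator_of_mem (Set.mem_Ioc.2 ⟨htc, htd.le⟩)]
    exact (hright htc).sub (hleft htd)
  · rw [Set.indicator_of_notMem (fun h => htd.not_ge h.2), ← sub_self B]
    exact (hright htc).sub (hright htd)

theorem hasStepLimit_of_monotone {p : ℝ≥0∞} [Fact (1 ≤ p)] (hp : p ≠ ∞) (hg : Monotone g)
    (hA : Tendsto g atBot (𝓝 A)) (hB : Tendsto g atTop (𝓝 B)) : HasStepLimit g p (B - A) := by
  refine ⟨hg.measurable.aestronglyMeasurable, fun c d hcd => ?_⟩
  have hrange : ∀ t, g t ∈ Set.Icc A B := fun t => ⟨hg.le_of_tendsto hA t, hg.ge_of_tendsto hB t⟩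
  have hpos : ∀ᶠ r : ℝ in atTop, ∀ t, 0 ≤ g (r * (t - c)) - g (r * (t - d)) := by
    filter_upwards [eventually_ge_atTop 0] with r hr t
    exact sub_nonneg.2 (hg (by gcongr))
  have hintegral : ∀ᶠ r : ℝ in atTop,
      Integrable (fun t => g (r * (t - c)) - g (r * (t - d))) volume ∧
        ∫ t, (g (r * (t - c)) - g (r * (t - d))) = (d - c) * (B - A) := by
    filter_upwards [eventually_gt_atTop 0] with r hr
    exact integrable_and_integral_sub_of_monotone (g := fun t => g (r * t))
      (fun s t hst => hg (by gcongr)) (hA.comp (tendsto_id.const_mul_atBot hr))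
      (hB.comp (tendsto_id.const_mul_atTop hr)) hcd.le
  refine tendsto_eLpNorm_of_tendsto_lintegral hp (C := ENNReal.ofReal (B - A))
    ENNReal.ofReal_ne_top ?_ (tendsto_lintegral_enorm_sub_of_tendsto_integral
      (hintegral.mono fun r hr => hr.1) (hpos.mono fun r hr => ae_of_all _ hr)
      ((integrable_indicator_iff measurableSet_Ioc).2 (by simp)) ?_ ?_)
  · filter_upwards [hpos] with r hr
    refine ae_of_all _ fun t => ?_
    rw [← ofReal_norm, Real.norm_eq_abs]
    refine ENNReal.ofReal_le_ofReal ?_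
    have hgc := hrange (r * (t - c))
    have hgd := hrange (r * (t - d))
    have hdiff := hr t
    by_cases ht : t ∈ Set.Ioc c d
    · rw [Set.indicator_of_mem ht, abs_le]
      constructor <;> linarith [hgc.2, hgd.1]
    · rw [Set.indicator_of_notMem ht, sub_zero, abs_of_nonneg hdiff]
      linarith [hgc.2, hgd.1]
  · filter_upwards [Measure.ae_ne volume c, Measure.ae_ne volume d] with t hc hd
    exact tendsto_sub_comp_mul_sub hA hB hcd hc hd
  · refine tendsto_const_nhds.congr' (hintegral.mono fun r hr => ?_)
    simp [hr.2, integral_indicator_const, hcd.le]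

end MonotoneStep

theorem tendsto_atTop_of_monotone_of_tendsto {ι α : Type*} [Preorder ι] [LinearOrder α]
    [TopologicalSpace α] [OrderTopology α] {g : ι → α} (hg : Monotone g) {l : Filter ι} [l.NeBot]
    (hl : l ≤ atTop) {a : α} (ha : Tendsto g l (𝓝 a)) : Tendsto g atTop (𝓝 a) := by
  refine tendsto_atTop_isLUB hg ⟨?_, fun u hu => le_of_tendsto' ha fun t => hu ⟨t, rfl⟩⟩
  rintro _ ⟨t, rfl⟩
  exact ge_of_tendsto ha (((eventually_ge_atTop t).filter_mono hl).mono fun s hs => hg hs)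

section Tails

variable {φ : ℝ → ℝ} {p : ℝ≥0∞} {a b X : ℝ} {Z : Set ℝ}

theorem neBot_atTop_inf_principal_compl (hZ : volume Z = 0) : (atTop ⊓ 𝓟 Zᶜ : Filter ℝ).NeBot := by
  refine inf_principal_neBot_iff.2 fun U hU => ?_
  obtain ⟨T, hT⟩ := mem_atTop_sets.1 hU
  by_contra! h
  refine (measure_mono_null (fun t ht => ?_) hZ).not_gt (by simp : 0 < volume (Set.Ici T))
  by_contra htZ
  exact Set.notMem_empty t (h ▸ ⟨hT t ht, htZ⟩)

theorem exists_monotone_ae_eq (hZ : volume Z = 0) (hmono : MonotoneOn φ (Set.Ioi X \ Z))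
    (ha : HasAELimit φ atTop a) :
    ∃ (Y : ℝ) (g : ℝ → ℝ), Monotone g ∧ Tendsto g atTop (𝓝 a) ∧ ∀ᵐ t, Y < t → g t = φ t := by
  obtain ⟨Z', hZ', hlim⟩ := ha
  obtain ⟨T, hT⟩ := eventually_atTop.1 (eventually_inf_principal.1
    (hlim.eventually (Icc_mem_nhds (sub_one_lt a) (lt_add_one a))))
  let s := Set.Ioi (max X T) \ (Z ∪ Z')
  have hrange : ∀ t ∈ s, φ t ∈ Set.Icc (a - 1) (a + 1) := fun t ht =>
    hT t ((le_max_right _ _).trans ht.1.le) fun h => ht.2 (Or.inr h)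
  obtain ⟨g, hg, hgφ⟩ := (hmono.mono (Set.sdiff_subset_sdiff (Set.Ioi_subset_Ioi (le_max_left X T))
    (Set.subset_union_left (t := Z')))).exists_monotone_extension
    ⟨a - 1, Set.forall_mem_image.2 fun t ht => (hrange t ht).1⟩
    ⟨a + 1, Set.forall_mem_image.2 fun t ht => (hrange t ht).2⟩
  have hnull : volume (Z ∪ Z') = 0 := measure_union_null hZ hZ'
  have := neBot_atTop_inf_principal_compl hnull
  refine ⟨max X T, g, hg, tendsto_atTop_of_monotone_of_tendsto (l := atTop ⊓ 𝓟 (Z ∪ Z')ᶜ) hg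
    inf_le_left ((hlim.mono_left ?_).congr' ?_), ?_⟩
  · exact inf_le_inf_left _
      (principal_mono.2 (Set.compl_subset_compl.2 Set.subset_union_right))
  · filter_upwards [mem_inf_of_left (Ioi_mem_atTop (max X T)),
      mem_inf_of_right (mem_principal_self _)] with t ht htZ
    exact hgφ ⟨ht, htZ⟩
  · filter_upwards [measure_eq_zero_iff_ae_notMem.1 hnull] with t htZ ht
    exact (hgφ ⟨ht, htZ⟩).symm

theorem hasStepLimit_indicator_Ioi_one [Fact (1 ≤ p)] (hp : p ≠ ∞) (Y : ℝ) :
    HasStepLimit ((Set.Ioi Y).indicator fun _ => 1) p 1 := by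
  have hmono : Monotone ((Set.Ioi Y).indicator fun _ => (1 : ℝ)) := fun s t hst => by
    by_cases hs : s ∈ Set.Ioi Y
    · rw [Set.indicator_of_mem hs, Set.indicator_of_mem (Set.mem_Ioi.2 (lt_of_lt_of_le hs hst))]
    · rw [Set.indicator_of_notMem hs]
      exact Set.indicator_nonneg (fun _ _ => zero_le_one) t
  have hlim := hasStepLimit_of_monotone hp hmono (A := 0) (B := 1)
    (tendsto_const_nhds.congr' ?_) (tendsto_const_nhds.congr' ?_)
  · rwa [sub_zero] at hlim
  · filter_upwards [eventually_le_atBot Y] with t ht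
    simp [ht]
  · filter_upwards [eventually_gt_atTop Y] with t ht
    simp [ht]

theorem hasStepLimit_indicator_Ioi_of_monotone [hp1 : Fact (1 ≤ p)] (hp : p ≠ ∞) {g : ℝ → ℝ}
    (hg : Monotone g) (ha : Tendsto g atTop (𝓝 a)) (Y : ℝ) :
    HasStepLimit ((Set.Ioi Y).indicator g) p a := by
  have hclamp : HasStepLimit (fun t => g (max t Y) - g Y) p (a - g Y) := by
    have h := hasStepLimit_of_monotone hp (g := fun t => g (max t Y) - g Y) (A := 0) (B := a - g Y)
      (fun s t hst => sub_le_sub_right (hg (max_le_max_right Y hst)) _) ?_ ?_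
    · simpa using h
    · refine tendsto_const_nhds.congr' ?_
      filter_upwards [eventually_le_atBot Y] with t ht
      rw [max_eq_right ht, sub_self]
    · refine (ha.congr' ?_).sub_const _
      filter_upwards [eventually_ge_atTop Y] with t ht
      rw [max_eq_left ht]
  have hsum := hclamp.add hp1.out ((hasStepLimit_indicator_Ioi_one hp Y).const_smul (g Y))
  rw [mul_one, sub_add_cancel] at hsum
  convert hsum using 1
  ext t
  rcases le_or_gt t Y with h | h
  · simp [h]
  · simp [h, h.le]

theorem eventually_hasStepLimit_indicator_Ioi [Fact (1 ≤ p)] (hp : p ≠ ∞)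
    (hmono : EssentiallyOn IsMonotoneOn φ (Set.Ioi X)) (ha : HasAELimit φ atTop a) :
    ∀ᶠ Y in atTop, HasStepLimit ((Set.Ioi Y).indicator φ) p a := by
  obtain ⟨Z, hZ, hmono⟩ := hmono
  wlog hφ : MonotoneOn φ (Set.Ioi X \ Z) generalizing φ a
  · have hanti := hmono.resolve_left hφ
    obtain ⟨Z', hZ', hlim⟩ := ha
    filter_upwards [this (φ := -φ) ⟨Z', hZ', hlim.neg⟩ (Or.inl hanti.neg) hanti.neg] with Y hY
    simpa [Set.indicator_neg'] using hY.const_smul (-1)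
  obtain ⟨Y₀, g, hg, hga, hgφ⟩ := exists_monotone_ae_eq hZ hφ ha
  filter_upwards [eventually_ge_atTop Y₀] with Y hY
  refine (hasStepLimit_indicator_Ioi_of_monotone hp hg hga Y).congr_ae ?_
  filter_upwards [hgφ] with t ht
  by_cases htY : t ∈ Set.Ioi Y
  · rw [Set.indicator_of_mem htY, Set.indicator_of_mem htY, ht (hY.trans_lt htY)]
  · rw [Set.indicator_of_notMem htY, Set.indicator_of_notMem htY]

theorem HasAELimit.comp_neg (hb : HasAELimit φ atBot b) : HasAELimit (fun t => φ (-t)) atTop b := by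
  obtain ⟨Z, hZ, hlim⟩ := hb
  refine ⟨Neg.neg ⁻¹' Z, (Measure.measurePreserving_neg volume).quasiMeasurePreserving.preimage_null
    hZ, hlim.comp (tendsto_neg_atTop_atBot.inf ?_)⟩
  exact tendsto_principal_principal.2 fun t ht => ht

theorem EssentiallyOn.isMonotoneOn_comp_neg (h : EssentiallyOn IsMonotoneOn φ (Set.Iio (-X))) :
    EssentiallyOn IsMonotoneOn (fun t => φ (-t)) (Set.Ioi X) := by
  obtain ⟨Z, hZ, hmono⟩ := h
  refine ⟨Neg.neg ⁻¹' Z, (Measure.measurePreserving_neg volume).quasiMeasurePreserving.preimage_null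
    hZ, ?_⟩
  have hmaps : Set.MapsTo Neg.neg (Set.Ioi X \ Neg.neg ⁻¹' Z) (Set.Iio (-X) \ Z) :=
    fun t ht => ⟨neg_lt_neg (Set.mem_Ioi.1 ht.1), ht.2⟩
  exact hmono.symm.imp (fun h => h.comp (fun s _ t _ hst => neg_le_neg hst) hmaps)
    fun h => MonotoneOn.comp_AntitoneOn h (fun s _ t _ hst => neg_le_neg hst) hmaps

theorem hasStepLimit_of_eventuallyEssentially_isMonotoneOn [hp1 : Fact (1 ≤ p)] (hp : p ≠ ∞)
    (hloc : ∀ R : ℝ, MemLp φ p (volume.restrict (Set.Icc (-R) R)))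
    (hmono : EventuallyEssentially IsMonotoneOn φ) (ha : HasAELimit φ atTop a)
    (hb : HasAELimit φ atBot b) : HasStepLimit φ p (a - b) := by
  obtain ⟨X, -, hright, hleft⟩ := hmono
  obtain ⟨Y, hY0, hYa, hYb⟩ := ((eventually_ge_atTop 0).and
    ((eventually_hasStepLimit_indicator_Ioi hp hright ha).and
    (eventually_hasStepLimit_indicator_Ioi hp hleft.isMonotoneOn_comp_neg hb.comp_neg))).exists
  have hcore : HasStepLimit ((Set.Icc (-Y) Y).indicator φ) p 0 :=
    .of_memLp hp1.out hp ((memLp_indicator_iff_restrict measurableSet_Icc).2 (hloc Y))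
  have hsum := (hYa.add hp1.out hYb.comp_neg).add hp1.out hcore
  rw [add_zero, ← sub_eq_add_neg] at hsum
  convert hsum using 1
  ext t
  rcases lt_or_ge t (-Y) with h | h
  · have h' : ¬ Y < t := by linarith
    simp [h', h.not_ge, lt_neg.1 h]
  rcases le_or_gt t Y with h' | h'
  · have h'' : ¬ Y < -t := by linarith
    simp [h, h', h'']
  · have h'' : ¬ Y < -t := by linarith
    simp [h', h'', h'.not_ge]

end Tails

section NetworkSpan

variable {V : Type*} [NormedAddCommGroup V] [InnerProductSpace ℝ V] {φ : ℝ → ℝ}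

/-- The functions on `V` represented by a shallow `φ` network, as a linear space. On `V = ℝ` the
neurons are the functions `t ↦ φ (y * t + ϱ)`. -/
def networkSpan (V : Type*) [NormedAddCommGroup V] [InnerProductSpace ℝ V] (φ : ℝ → ℝ) :
    Submodule ℝ (V → ℝ) :=
  Submodule.span ℝ (Set.range fun q : V × ℝ => fun x => φ (inner ℝ q.1 x + q.2))

theorem comp_mul_sub_mem_networkSpan (φ : ℝ → ℝ) (r c : ℝ) :
    (fun t => φ (r * (t - c))) ∈ networkSpan ℝ φ := by
  refine Submodule.subset_span ⟨(r, -(r * c)), ?_⟩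
  ext t
  simp [← sub_eq_add_neg, mul_sub, mul_comm]

theorem comp_inner_mem_networkSpan {G : ℝ → ℝ} (hG : G ∈ networkSpan ℝ φ) (v : V) :
    G ∘ (fun x => inner ℝ v x) ∈ networkSpan V φ := by
  have hle : networkSpan ℝ φ ≤
      (networkSpan V φ).comap (LinearMap.funLeft ℝ ℝ fun x : V => inner ℝ v x) := by
    refine Submodule.span_le.2 ?_
    rintro _ ⟨q, rfl⟩
    refine Submodule.subset_span ⟨(q.1 • v, q.2), ?_⟩
    ext x
    simp [LinearMap.funLeft, inner_smul_left, mul_comm]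
  exact hle hG

variable {p : ℝ≥0∞} [Fact (1 ≤ p)]

theorem HasStepLimit.indicator_Ioc_mem_lpClosure {s : ℝ} (h : HasStepLimit φ p s) (hs : s ≠ 0)
    {c d : ℝ} (hcd : c < d) :
    (Set.Ioc c d).indicator (fun _ => (1 : ℝ)) ∈ lpClosure (networkSpan ℝ φ) p volume := by
  have hone : (Set.Ioc c d).indicator (fun _ => (1 : ℝ)) =
      s⁻¹ • (Set.Ioc c d).indicator fun _ => s := by
    ext t
    by_cases ht : t ∈ Set.Ioc c d <;> simp [ht, hs]
  rw [hone]
  refine Submodule.smul_mem _ _ ?_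
  have hstep : MemLp ((Set.Ioc c d).indicator fun _ => s) p volume :=
    memLp_indicator_const p measurableSet_Ioc s (Or.inr (by simp))
  refine mem_lpClosure_of_tendsto (l := atTop)
    (G := fun r t => φ (r * (t - c)) - φ (r * (t - d))) hstep ?_
    ((h.tendsto c d hcd).congr fun r => eLpNorm_sub_comm _ _ _ _)
  filter_upwards [(h.tendsto c d hcd).eventually_lt_const zero_lt_one, eventually_ne_atTop 0]
    with r hr hr0
  refine mem_lpClosure_of_mem (Submodule.sub_mem _ (comp_mul_sub_mem_networkSpan φ r c)
    (comp_mul_sub_mem_networkSpan φ r d)) ?_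
  have herror : MemLp (fun t => φ (r * (t - c)) - φ (r * (t - d)) -
      (Set.Ioc c d).indicator (fun _ => s) t) p volume :=
    ⟨h.aestronglyMeasurable_error hr0 c d, hr.trans ENNReal.one_lt_top⟩
  convert! herror.add hstep using 1
  ext t
  simp

end NetworkSpan

end StepLimit

section StepFunctions

theorem sum_indicator_Ioc_div_apply (w : ℤ → ℝ) {L : ℕ} (hL : 0 < L) (M : ℕ) (t : ℝ) :
    (∑ k ∈ Finset.Ioc (-(M * L) : ℤ) (M * L),
      w k • (Set.Ioc ((k - 1) / L : ℝ) (k / L)).indicator (fun _ => (1 : ℝ))) t =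
      (Set.Ioc (-M : ℝ) M).indicator (fun t => w ⌈t * L⌉) t := by
  have hL0 : (0 : ℝ) < L := by exact_mod_cast hL
  have hmem : ∀ k : ℤ, t ∈ Set.Ioc ((k - 1) / L : ℝ) (k / L) ↔ k = ⌈t * L⌉ := by
    intro k
    rw [Set.mem_Ioc, div_lt_iff₀ hL0, le_div_iff₀ hL0, eq_comm, Int.ceil_eq_iff]
  have hiff : t ∈ Set.Ioc (-M : ℝ) M ↔ ⌈t * L⌉ ∈ Finset.Ioc (-(M * L) : ℤ) (M * L) := by
    rw [Finset.mem_Ioc, Int.lt_ceil, Int.ceil_le]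
    push_cast
    rw [← neg_mul, mul_lt_mul_iff_left₀ hL0, mul_le_mul_iff_left₀ hL0, Set.mem_Ioc]
  simp only [Finset.sum_apply, Pi.smul_apply, Set.indicator, smul_eq_mul, mul_ite, mul_one,
    mul_zero, hmem, Finset.sum_ite_eq', hiff]

theorem abs_sub_ceil_div_le (t : ℝ) {L : ℕ} (hL : 0 < L) : |t - ⌈t * L⌉ / L| ≤ 1 / L := by
  have hL0 : (0 : ℝ) < L := by exact_mod_cast hL
  have h1 : t ≤ ⌈t * L⌉ / L := (le_div_iff₀ hL0).2 (Int.le_ceil _)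
  have h2 : (⌈t * L⌉ : ℝ) / L ≤ t + 1 / L := by
    rw [div_le_iff₀ hL0, add_mul, div_mul_cancel₀ _ hL0.ne']
    exact (Int.ceil_lt_add_one _).le
  rw [abs_le]
  constructor <;> linarith [hL0.le]

theorem exists_forall_lt_abs_eq_zero {f : ℝ → ℝ} (hfc : HasCompactSupport f) :
    ∃ R : ℝ, ∀ t, R < |t| → f t = 0 := by
  obtain ⟨R, hR⟩ := hfc.isCompact.isBounded.exists_norm_le
  refine ⟨R, fun t ht => by_contra fun h => ?_⟩
  exact ht.not_ge (hR t (subset_tsupport f h))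

theorem mem_lpClosure_of_hasCompactSupport {p : ℝ≥0∞} [Fact (1 ≤ p)] {S : Submodule ℝ (ℝ → ℝ)}
    (hS : ∀ c d : ℝ, c < d → (Set.Ioc c d).indicator (fun _ => (1 : ℝ)) ∈ lpClosure S p volume)
    {f : ℝ → ℝ} (hf : Continuous f) (hfc : HasCompactSupport f) :
    f ∈ lpClosure S p volume := by
  obtain ⟨R, hR⟩ := exists_forall_lt_abs_eq_zero hfc
  obtain ⟨M, hM⟩ := exists_nat_gt R
  have hzero : ∀ t ∉ Set.Ioc (-M : ℝ) M, f t = 0 := fun t ht =>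
    hR t (hM.trans_le (not_lt.1 fun h => ht ⟨(abs_lt.1 h).1, (abs_lt.1 h).2.le⟩))
  refine mem_lpClosure_of_forall_le (hf.memLp_of_hasCompactSupport hfc)
    (k := (Set.Ioc (-M : ℝ) M).indicator fun _ => 1)
    (memLp_indicator_const p measurableSet_Ioc 1 (Or.inr (by simp))) fun δ hδ => ?_
  obtain ⟨η, hη, hfη⟩ := Metric.uniformContinuous_iff.1
    (hfc.uniformContinuous_of_continuous hf) δ hδ
  obtain ⟨N, hN⟩ := exists_nat_one_div_lt hη
  have hmem : ∀ k : ℤ, (Set.Ioc ((k - 1) / (N + 1 : ℕ) : ℝ) (k / (N + 1 : ℕ))).indicator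
      (fun _ => (1 : ℝ)) ∈ lpClosure S p volume := fun k => hS _ _ (by gcongr; linarith)
  refine ⟨_, Submodule.sum_mem _ (t := Finset.Ioc (-(M * (N + 1 : ℕ)) : ℤ) (M * (N + 1 : ℕ)))
    fun k _ => Submodule.smul_mem _ (f (k / (N + 1 : ℕ))) (hmem k), ae_of_all _ fun t => ?_⟩
  rw [sum_indicator_Ioc_div_apply (fun k => f (k / (N + 1 : ℕ))) N.succ_pos M t]
  by_cases ht : t ∈ Set.Ioc (-M : ℝ) M
  · rw [Set.indicator_of_mem ht, Set.indicator_of_mem ht, mul_one]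
    exact (hfη ((abs_sub_ceil_div_le t N.succ_pos).trans_lt (by exact_mod_cast hN))).le
  · rw [Set.indicator_of_notMem ht, Set.indicator_of_notMem ht, hzero t ht]
    simp

end StepFunctions

section Derivatives

variable {f F : ℝ → ℝ}

theorem exists_hasCompactSupport_hasDerivAt_sub_mul (hf : Continuous f)
    (hfc : HasCompactSupport f) {s : ℝ} (hs : 0 < s) :
    ∃ F : ℝ → ℝ, HasCompactSupport F ∧ ∀ t, HasDerivAt F (f t - s * f (s * t)) t := by
  obtain ⟨R, hR⟩ := exists_forall_lt_abs_eq_zero hfc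
  refine ⟨fun t => (∫ u in 0..t, f u) - ∫ u in 0..s * t, f u, ?_, fun t => ?_⟩
  · refine HasCompactSupport.intro (isCompact_closedBall (0 : ℝ) (max R (R / s))) fun t ht => ?_
    rw [mem_closedBall_zero_iff, not_le, max_lt_iff, div_lt_iff₀' hs, Real.norm_eq_abs] at ht
    rw [intervalIntegral.integral_interval_sub_left (hf.intervalIntegrable _ _)
      (hf.intervalIntegrable _ _), ← intervalIntegral.integral_zero (a := s * t) (b := t)]
    refine intervalIntegral.integral_congr fun u hu => hR u ?_
    rcases le_total 0 t with h0 | h0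
    · rw [abs_of_nonneg h0] at ht
      exact ((lt_min ht.2 ht.1).trans_le hu.1).trans_le (le_abs_self u)
    · rw [abs_of_nonpos h0, mul_neg, lt_neg, lt_neg (a := R)] at ht
      exact (lt_neg.1 (hu.2.trans_lt (max_lt ht.2 ht.1))).trans_le (neg_le_abs u)
  · have hderiv : ∀ t, HasDerivAt (fun t => ∫ u in 0..t, f u) (f t) t := fun t =>
      intervalIntegral.integral_hasDerivAt_right (hf.intervalIntegrable _ _)
        (hf.stronglyMeasurableAtFilter _ _) hf.continuousAt
    have hscale : HasDerivAt (fun t => s * t) s t := by simpa using (hasDerivAt_id t).const_mul s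
    simpa only [mul_comm s, Function.comp_def] using
      (hderiv t).fun_sub ((hderiv (s * t)).comp t hscale)

theorem tendsto_eLpNorm_mul_comp_mul_left {p : ℝ≥0∞} (hp1 : 1 < p) (hp : p ≠ ∞)
    (hf : MemLp f p volume) :
    Tendsto (fun s : ℝ => eLpNorm (fun t => s * f (s * t)) p volume) (𝓝[>] 0) (𝓝 0) := by
  have hexp : 0 < 1 - (1 / p).toReal := by
    rw [one_div, ENNReal.toReal_inv, sub_pos]
    exact inv_lt_one_of_one_lt₀ (by simpa using ENNReal.toReal_strict_mono hp hp1)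
  have hpow : Tendsto (fun s : ℝ => ENNReal.ofReal (s ^ (1 - (1 / p).toReal))) (𝓝[>] 0) (𝓝 0) := by
    have h := (ENNReal.continuous_ofReal.comp
      (Real.continuous_rpow_const hexp.le)).tendsto (0 : ℝ)
    rw [Function.comp_apply, Real.zero_rpow hexp.ne', ENNReal.ofReal_zero] at h
    exact h.mono_left nhdsWithin_le_nhds
  have hlim := ENNReal.Tendsto.mul_const (b := eLpNorm f p volume) hpow (Or.inr hf.2.ne)
  rw [zero_mul] at hlim
  refine hlim.congr' ?_
  filter_upwards [self_mem_nhdsWithin] with s (hs : 0 < s)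
  have hsmul : (fun t => s * f (s * t)) = s • fun t => f (s * t) := rfl
  rw [hsmul, eLpNorm_const_smul, eLpNorm_comp_mul_left hp hs.ne', ← mul_assoc, abs_inv,
    Real.enorm_eq_ofReal_abs, abs_of_pos hs, Real.rpow_sub hs, Real.rpow_one,
    ENNReal.ofReal_rpow_of_pos (inv_pos.2 hs), ← ENNReal.ofReal_mul hs.le, Real.inv_rpow hs.le,
    div_eq_mul_inv]

theorem hasCompactSupport_of_hasDerivAt (hFc : HasCompactSupport F)
    (hF : ∀ t, HasDerivAt F (f t) t) : HasCompactSupport f :=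
  (funext fun t => (hF t).deriv : deriv F = f) ▸ hFc.deriv

theorem exists_forall_abs_mul_sub_slope_le (hf : UniformContinuous f)
    (hF : ∀ t, HasDerivAt F (f t) t) {δ : ℝ} (hδ : 0 < δ) :
    ∃ τ ∈ Set.Ioc (0 : ℝ) 1, ∀ s, ∀ y ∈ Set.Icc (0 : ℝ) 1,
      |f s * y - τ⁻¹ * (F (s + τ * y) - F s)| ≤ δ := by
  obtain ⟨η, hη, hfη⟩ := Metric.uniformContinuous_iff.1 hf δ hδ
  have hτ : 0 < min (η / 2) 1 := lt_min (half_pos hη) one_pos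
  refine ⟨min (η / 2) 1, ⟨hτ, min_le_right _ _⟩, fun s y hy => ?_⟩
  set τ := min (η / 2) 1
  have hτy : τ * y ∈ Set.Icc 0 τ := ⟨mul_nonneg hτ.le hy.1, mul_le_of_le_one_right hτ.le hy.2⟩
  have hderiv : ∀ h ∈ Set.Icc 0 τ, HasDerivWithinAt (fun h => F (s + h) - f s * h)
      (f (s + h) - f s) (Set.Icc 0 τ) h := fun h _ =>
    (((hF (s + h)).comp_const_add s h).sub
      (by simpa using (hasDerivAt_id h).const_mul (f s))).hasDerivWithinAt
  have hbound : ∀ h ∈ Set.Icc 0 τ, ‖f (s + h) - f s‖ ≤ δ := fun h hh => by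
    refine (hfη ?_).le
    rw [dist_self_add_left, Real.norm_of_nonneg hh.1]
    exact (hh.2.trans (min_le_left _ _)).trans_lt (half_lt_self hη)
  have htaylor := (convex_Icc 0 τ).norm_image_sub_le_of_norm_hasDerivWithin_le hderiv hbound
    (Set.left_mem_Icc.2 hτ.le) hτy
  have hfactor : f s * y - τ⁻¹ * (F (s + τ * y) - F s) =
      -(τ⁻¹ * (F (s + τ * y) - f s * (τ * y) - (F (s + 0) - f s * 0))) := by
    rw [add_zero]
    field_simp
    ring
  rw [hfactor, abs_neg, abs_mul, abs_of_pos (inv_pos.2 hτ), inv_mul_le_iff₀ hτ, mul_comm τ δ]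
  refine htaylor.trans (mul_le_mul_of_nonneg_left ?_ hδ.le)
  rw [sub_zero, Real.norm_of_nonneg hτy.1]
  exact hτy.2

theorem exists_forall_abs_mul_sub_slope_le_indicator (hf : Continuous f)
    (hFc : HasCompactSupport F) (hF : ∀ t, HasDerivAt F (f t) t) :
    ∃ M : ℝ, ∀ δ > 0, ∃ τ : ℝ, ∀ s, ∀ y ∈ Set.Icc (0 : ℝ) 1,
      |f s * y - τ⁻¹ * (F (s + τ * y) - F s)| ≤
        δ * (Set.Icc (-M) M).indicator (fun _ => 1) s := by
  have hfc := hasCompactSupport_of_hasDerivAt hFc hF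
  obtain ⟨R, hR⟩ := exists_forall_lt_abs_eq_zero hFc
  obtain ⟨R', hR'⟩ := exists_forall_lt_abs_eq_zero hfc
  refine ⟨max (R + 1) R', fun δ hδ => ?_⟩
  obtain ⟨τ, hτ, h⟩ := exists_forall_abs_mul_sub_slope_le
    (hfc.uniformContinuous_of_continuous hf) hF hδ
  refine ⟨τ, fun s y hy => ?_⟩
  by_cases hs : s ∈ Set.Icc (-max (R + 1) R') (max (R + 1) R')
  · rw [Set.indicator_of_mem hs, mul_one]
    exact h s y hy
  · obtain ⟨hsR, hsR'⟩ := max_lt_iff.1 (not_le.1 fun h => hs (abs_le.1 h))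
    have hshift : R < |s + τ * y| := by
      have hτy : |τ * y| ≤ 1 := by
        rw [abs_of_nonneg (mul_nonneg hτ.1.le hy.1)]
        exact mul_le_one₀ hτ.2 hy.1 hy.2
      have htri := abs_sub_abs_le_abs_sub s (-(τ * y))
      rw [abs_neg, sub_neg_eq_add] at htri
      linarith
    rw [Set.indicator_of_notMem hs, hR s (by linarith), hR _ hshift, hR' s hsR']
    simp

end Derivatives

section Strip

variable {n : ℕ}

theorem measurePreserving_fst_add {E : Type*} [MeasurableSpace E] {μ : Measure E}
    [IsProbabilityMeasure μ] {h : E → ℝ} (hh : Measurable h) :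
    MeasurePreserving (fun z : ℝ × E => z.1 + h z.2) (volume.prod μ) volume :=
  have hshear : MeasurePreserving (fun z : E × ℝ => (z.1, z.2 + h z.1)) (μ.prod volume)
      (μ.prod volume) :=
    (MeasurePreserving.id μ).skew_product (g := fun y t => t + h y) (by fun_prop)
      (ae_of_all _ fun y => (measurePreserving_add_right volume (h y)).map_eq)
  measurePreserving_snd.comp (hshear.comp Measure.measurePreserving_swap)

theorem measurableSet_lineTimesCube (n : ℕ) : MeasurableSet (lineTimesCube n) := by
  simp only [lineTimesCube, Set.ofPred_forall]
  exact MeasurableSet.iInter fun i => measurableSet_Icc.preimage (by fun_prop)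

theorem isCompact_lineTimesCube_inter (n : ℕ) (M : ℝ) :
    IsCompact (lineTimesCube n ∩ {x | |x 0| ≤ M}) := by
  let I : Fin (n + 1) → Set ℝ := Fin.cons (Set.Icc (-M) M) fun _ => Set.Icc 0 1
  have hI : ∀ i, IsCompact (I i) := Fin.cases isCompact_Icc fun _ => isCompact_Icc
  convert! (isCompact_univ_pi hI).image (PiLp.continuous_toLp 2 fun _ => ℝ) using 1
  ext x
  have hx : x ∈ lineTimesCube n ∩ {x | |x 0| ≤ M} ↔ x.ofLp ∈ Set.univ.pi I := by
    simp [I, lineTimesCube, Fin.forall_fin_succ, abs_le, and_comm]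
  rw [hx]
  exact ⟨fun h => ⟨x.ofLp, h, rfl⟩, by rintro ⟨y, hy, rfl⟩; exact hy⟩

theorem measurePreserving_inner {v : EuclideanSpace ℝ (Fin (n + 1))} (hv : v 0 = 1) :
    MeasurePreserving (fun x => inner ℝ v x) (volume.restrict (lineTimesCube n)) volume := by
  let e : EuclideanSpace ℝ (Fin (n + 1)) → ℝ × (Fin n → ℝ) := fun x => (x 0, fun i => x i.succ)
  have he : MeasurePreserving e volume volume :=
    (volume_preserving_piFinSuccAbove (fun _ : Fin (n + 1) => ℝ) 0).comp
      (PiLp.volume_preserving_ofLp (Fin (n + 1)))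
  have hcube : IsProbabilityMeasure (volume.restrict (Set.Icc (0 : Fin n → ℝ) 1)) :=
    ⟨by simp [Real.volume_Icc_pi]⟩
  have hpre : e ⁻¹' (Set.univ ×ˢ Set.Icc 0 1) = lineTimesCube n := by
    ext x
    simp [e, lineTimesCube, Pi.le_def, forall_and]
  have hrestrict := he.restrict_preimage
    (MeasurableSet.univ.prod (measurableSet_Icc (a := (0 : Fin n → ℝ)) (b := 1)))
  rw [hpre, Measure.volume_eq_prod, ← Measure.prod_restrict, Measure.restrict_univ] at hrestrict
  convert! (measurePreserving_fst_add (h := fun y : Fin n → ℝ => ∑ i, v i.succ * y i)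
    (by fun_prop)).comp hrestrict using 1
  ext x
  simp [e, PiLp.inner_apply, Fin.sum_univ_succ, hv, mul_comm]

end Strip

section Multipliers

variable {n : ℕ} {p : ℝ≥0∞} {v : EuclideanSpace ℝ (Fin (n + 1))}
  {u : EuclideanSpace ℝ (Fin (n + 1)) → ℝ} {B : ℝ}

theorem abs_coord_mul_le (hB : ∀ x ∈ lineTimesCube n, |u x| ≤ B) (i : Fin n) :
    ∀ x ∈ lineTimesCube n, |x i.succ * u x| ≤ B := fun x hx => by
  rw [abs_mul, abs_of_nonneg (hx i).1]
  exact (mul_le_of_le_one_left (abs_nonneg _) (hx i).2).trans (hB x hx)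

theorem eLpNorm_ridge_mul_le {f : ℝ → ℝ} (hf : AEStronglyMeasurable f volume) (hv : v 0 = 1)
    (hB : ∀ x ∈ lineTimesCube n, |u x| ≤ B) :
    eLpNorm (fun x => f (inner ℝ v x) * u x) p (volume.restrict (lineTimesCube n)) ≤
      ENNReal.ofReal B * eLpNorm f p volume := by
  rw [← eLpNorm_comp_measurePreserving hf (measurePreserving_inner hv)]
  refine eLpNorm_le_mul_eLpNorm_of_ae_le_mul ?_ p
  filter_upwards [ae_restrict_mem (measurableSet_lineTimesCube n)] with x hx
  rw [norm_mul, mul_comm]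
  exact mul_le_mul_of_nonneg_right (hB x hx) (norm_nonneg _)

theorem memLp_ridge_mul {f : ℝ → ℝ} (hf : MemLp f p volume) (hv : v 0 = 1) (hu : Continuous u)
    (hB : ∀ x ∈ lineTimesCube n, |u x| ≤ B) :
    MemLp (fun x => f (inner ℝ v x) * u x) p (volume.restrict (lineTimesCube n)) :=
  ⟨(hf.1.comp_measurePreserving (measurePreserving_inner hv)).mul hu.aestronglyMeasurable,
    (eLpNorm_ridge_mul_le hf.1 hv hB).trans_lt (ENNReal.mul_lt_top ENNReal.ofReal_lt_top hf.2)⟩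

variable [Fact (1 ≤ p)] {S : Submodule ℝ (EuclideanSpace ℝ (Fin (n + 1)) → ℝ)}

/-- Continuous functions `u`, bounded on `ℝ × [0,1]^n`, whose products with the ridge functions
`x ↦ f ⟨v, x⟩`, for `f` continuous with compact support and `v 0 = 1`, can be approximated by
elements of `S`. The polynomials in the cube coordinates are shown to be of this kind. -/
structure IsRidgeMultiplier (S : Submodule ℝ (EuclideanSpace ℝ (Fin (n + 1)) → ℝ)) (p : ℝ≥0∞)
    [Fact (1 ≤ p)] (u : EuclideanSpace ℝ (Fin (n + 1)) → ℝ) : Prop where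
  continuous : Continuous u
  bounded : ∃ B : ℝ, ∀ x ∈ lineTimesCube n, |u x| ≤ B
  mem : ∀ f : ℝ → ℝ, Continuous f → HasCompactSupport f →
    ∀ v : EuclideanSpace ℝ (Fin (n + 1)), v 0 = 1 →
      (fun x => f (inner ℝ v x) * u x) ∈ lpClosure S p (volume.restrict (lineTimesCube n))

namespace IsRidgeMultiplier

theorem mem_of_hasDerivAt (hu : IsRidgeMultiplier S p u) (i : Fin n) {f F : ℝ → ℝ}
    (hf : Continuous f) (hFc : HasCompactSupport F) (hF : ∀ t, HasDerivAt F (f t) t)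
    (hv : v 0 = 1) :
    (fun x => f (inner ℝ v x) * (x i.succ * u x)) ∈
      lpClosure S p (volume.restrict (lineTimesCube n)) := by
  obtain ⟨B, hB⟩ := hu.bounded
  obtain ⟨M, hM⟩ := exists_forall_abs_mul_sub_slope_le_indicator hf hFc hF
  have hFcont : Continuous F := continuous_iff_continuousAt.2 fun t => (hF t).continuousAt
  have hfLp : MemLp f p volume :=
    hf.memLp_of_hasCompactSupport (hasCompactSupport_of_hasDerivAt hFc hF)
  have hkLp : MemLp ((Set.Icc (-M) M).indicator fun _ => (1 : ℝ)) p volume :=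
    memLp_indicator_const p measurableSet_Icc 1 (Or.inr (by simp))
  refine mem_lpClosure_of_forall_le
    (memLp_ridge_mul hfLp hv (Continuous.mul (by fun_prop) hu.continuous) (abs_coord_mul_le hB i))
    ((hkLp.comp_measurePreserving (measurePreserving_inner hv)).mul_const B) fun δ hδ => ?_
  obtain ⟨τ, hτ⟩ := hM δ hδ
  -- The directional difference quotient `τ⁻¹ (F ⟨v + τ eᵢ, x⟩ - F ⟨v, x⟩)` tends to
  -- `f ⟨v, x⟩ xᵢ`.
  set w : EuclideanSpace ℝ (Fin (n + 1)) := v + τ • EuclideanSpace.single i.succ 1 with hw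
  have hw0 : w 0 = 1 := by simp [hw, hv]
  refine ⟨_, Submodule.smul_mem _ τ⁻¹ (Submodule.sub_mem _ (hu.mem F hFcont hFc w hw0)
    (hu.mem F hFcont hFc v hv)), ?_⟩
  filter_upwards [ae_restrict_mem (measurableSet_lineTimesCube n)] with x hx
  have hwx : inner ℝ w x = inner ℝ v x + τ * x i.succ := by
    simp [hw, inner_add_left, inner_smul_left, EuclideanSpace.inner_single_left]
  have hslope := hτ (inner ℝ v x) (x i.succ) (hx i)
  simp only [Pi.smul_apply, Pi.sub_apply, smul_eq_mul, Function.comp_apply, hwx, ← sub_mul,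
    ← mul_assoc]
  rw [abs_mul]
  exact mul_le_mul hslope (hB x hx) (abs_nonneg _) ((abs_nonneg _).trans hslope)

theorem coord_mul (hp1 : 1 < p) (hp : p ≠ ∞) (hu : IsRidgeMultiplier S p u) (i : Fin n) :
    IsRidgeMultiplier S p (fun x => x i.succ * u x) := by
  have hcont : Continuous fun x : EuclideanSpace ℝ (Fin (n + 1)) => x i.succ * u x :=
    Continuous.mul (by fun_prop) hu.continuous
  obtain ⟨B, hB⟩ := hu.bounded
  have hiB := abs_coord_mul_le hB i
  refine ⟨hcont, ⟨B, hiB⟩, fun f hf hfc v hv => ?_⟩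
  have hfLp : MemLp f p volume := hf.memLp_of_hasCompactSupport hfc
  refine mem_lpClosure_of_tendsto (l := 𝓝[>] (0 : ℝ))
    (G := fun s x => (f (inner ℝ v x) - s * f (s * inner ℝ v x)) * (x i.succ * u x))
    (memLp_ridge_mul hfLp hv hcont hiB) ?_ ?_
  · filter_upwards [self_mem_nhdsWithin] with s (hs : 0 < s)
    obtain ⟨F, hFc, hF⟩ := exists_hasCompactSupport_hasDerivAt_sub_mul hf hfc hs
    exact hu.mem_of_hasDerivAt i (by fun_prop) hFc hF hv
  · have hlim := ENNReal.Tendsto.const_mul (a := ENNReal.ofReal B)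
      (tendsto_eLpNorm_mul_comp_mul_left hp1 hp hfLp) (Or.inr ENNReal.ofReal_ne_top)
    rw [mul_zero] at hlim
    refine tendsto_of_tendsto_of_tendsto_of_le_of_le tendsto_const_nhds hlim
      (fun _ => zero_le) fun s => ?_
    refine le_of_eq_of_le ?_ (eLpNorm_ridge_mul_le
      (f := fun t => s * f (s * t)) (by fun_prop) hv hiB)
    congr 1
    ext x
    simp only [Pi.sub_apply]
    ring

theorem prod_pow_mul (hp1 : 1 < p) (hp : p ≠ ∞) (hu : IsRidgeMultiplier S p u) (m : Fin n → ℕ) :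
    IsRidgeMultiplier S p (fun x => (∏ i, x i.succ ^ m i) * u x) := by
  let T : Submonoid (EuclideanSpace ℝ (Fin (n + 1)) → ℝ) :=
    { carrier := {w | ∀ u, IsRidgeMultiplier S p u → IsRidgeMultiplier S p (w * u)}
      one_mem' := fun u hu => by rwa [one_mul]
      mul_mem' := fun {w w'} hw hw' u hu => by
        rw [mul_assoc]
        exact hw _ (hw' _ hu) }
  have hT : ∏ i, (fun x : EuclideanSpace ℝ (Fin (n + 1)) => x i.succ) ^ m i ∈ T :=
    Submonoid.prod_mem _ fun i _ => Submonoid.pow_mem _ (fun u hu => hu.coord_mul hp1 hp i) _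
  convert! hT u hu using 1
  ext x
  simp

theorem mul_mvPolynomial_mem (hp1 : 1 < p) (hp : p ≠ ∞)
    (h1 : IsRidgeMultiplier S p (fun _ => 1)) {f : ℝ → ℝ} (hf : Continuous f)
    (hfc : HasCompactSupport f) (P : MvPolynomial (Fin (n + 1)) ℝ) :
    (fun x : EuclideanSpace ℝ (Fin (n + 1)) => f (x 0) * MvPolynomial.eval (fun i => x i) P) ∈
      lpClosure S p (volume.restrict (lineTimesCube n)) := by
  induction P using MvPolynomial.induction_on' with
  | monomial m c =>
    have hmem := (h1.prod_pow_mul hp1 hp (fun i => m i.succ)).mem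
      (fun t => c * (f t * t ^ m 0)) (by fun_prop) (hfc.mul_right.mul_left)
      (EuclideanSpace.single 0 1) (by simp)
    convert hmem using 1
    ext x
    simp only [MvPolynomial.eval_monomial, EuclideanSpace.inner_single_left, map_one, one_mul,
      mul_one, Finsupp.prod_fintype _ _ (fun _ => pow_zero _), Fin.prod_univ_succ]
    ring
  | add P Q hP hQ =>
    convert Submodule.add_mem _ hP hQ using 1
    ext x
    simp only [map_add, Pi.add_apply]
    ring

end IsRidgeMultiplier

theorem exists_mvPolynomial_abs_sub_le {d : ℕ} {K : Set (EuclideanSpace ℝ (Fin d))}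
    (hK : IsCompact K) {g : EuclideanSpace ℝ (Fin d) → ℝ} (hg : ContinuousOn g K) {δ : ℝ}
    (hδ : 0 < δ) :
    ∃ P : MvPolynomial (Fin d) ℝ, ∀ x ∈ K, |g x - MvPolynomial.eval (fun i => x i) P| ≤ δ := by
  have : CompactSpace K := isCompact_iff_compactSpace.1 hK
  let X : Fin d → C(K, ℝ) := fun i => ⟨fun x => (x : EuclideanSpace ℝ (Fin d)) i, by fun_prop⟩
  have hsep : (MvPolynomial.aeval (R := ℝ) X).range.SeparatesPoints := by
    intro x y hxy
    obtain ⟨i, hi⟩ : ∃ i, (x : EuclideanSpace ℝ (Fin d)) i ≠ (y : EuclideanSpace ℝ (Fin d)) i := by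
      by_contra! h
      exact hxy (Subtype.ext (PiLp.ext h))
    exact ⟨X i, ⟨X i, ⟨MvPolynomial.X i, by simp⟩, rfl⟩, hi⟩
  obtain ⟨⟨q, P, hP⟩, hq⟩ :=
    ContinuousMap.exists_mem_subalgebra_near_continuousMap_of_separatesPoints _ hsep
      ⟨K.domRestrict g, hg.domRestrict⟩ δ hδ
  refine ⟨P, fun x hx => ?_⟩
  have heval : q ⟨x, hx⟩ = MvPolynomial.eval (fun i => x i) P := by
    rw [← hP]
    change ContinuousMap.evalAlgHom ℝ ℝ (⟨x, hx⟩ : K) (MvPolynomial.aeval X P) = _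
    exact DFunLike.congr_fun (MvPolynomial.algHom_ext
      (f := (ContinuousMap.evalAlgHom ℝ ℝ (⟨x, hx⟩ : K)).comp (MvPolynomial.aeval X))
      (g := MvPolynomial.aeval fun i => x i) fun i => by simp [X]) P
  rw [← heval, abs_sub_comm]
  exact (ContinuousMap.norm_coe_le_norm _ (⟨x, hx⟩ : K)).trans hq.le

namespace IsRidgeMultiplier

theorem mem_lpClosure_of_hasCompactSupport (hp1 : 1 < p) (hp : p ≠ ∞)
    (h1 : IsRidgeMultiplier S p (fun _ => 1)) {g : EuclideanSpace ℝ (Fin (n + 1)) → ℝ}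
    (hg : Continuous g) (hgc : HasCompactSupport g) :
    g ∈ lpClosure S p (volume.restrict (lineTimesCube n)) := by
  obtain ⟨M, hM0, hM⟩ := hgc.isCompact.isBounded.exists_pos_norm_le
  let β : ContDiffBump (0 : ℝ) := ⟨M, M + 1, hM0, by linarith⟩
  have hβLp : MemLp (fun x : EuclideanSpace ℝ (Fin (n + 1)) => β (x 0)) p
      (volume.restrict (lineTimesCube n)) := by
    simpa [Function.comp_def, EuclideanSpace.inner_single_left] using
      (β.continuous.memLp_of_hasCompactSupport (p := p) β.hasCompactSupport).comp_measurePreserving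
        (measurePreserving_inner (v := EuclideanSpace.single (0 : Fin (n + 1)) 1) (by simp))
  have hgβ : ∀ x, g x = β (x 0) * g x := by
    intro x
    by_cases hx : g x = 0
    · rw [hx, mul_zero]
    · have hx0 := (PiLp.norm_apply_le x 0).trans (hM x (subset_tsupport g hx))
      rw [β.one_of_mem_closedBall (by simpa using hx0), one_mul]
  refine mem_lpClosure_of_forall_le
    ((hg.memLp_of_hasCompactSupport hgc (μ := volume)).restrict _) hβLp fun δ hδ => ?_
  obtain ⟨P, hP⟩ := exists_mvPolynomial_abs_sub_le (isCompact_lineTimesCube_inter n (M + 1))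
    hg.continuousOn hδ
  refine ⟨_, h1.mul_mvPolynomial_mem hp1 hp β.continuous β.hasCompactSupport P, ?_⟩
  filter_upwards [ae_restrict_mem (measurableSet_lineTimesCube n)] with x hx
  rw [hgβ x, ← mul_sub, abs_mul, abs_of_nonneg β.nonneg, mul_comm]
  by_cases hx0 : |x 0| ≤ M + 1
  · exact mul_le_mul_of_nonneg_right (hP x ⟨hx, hx0⟩) β.nonneg
  · have hβ0 : β (x 0) = 0 := β.zero_of_le_dist (by simpa using (not_le.1 hx0).le)
    simp [hβ0]

theorem mem_lpClosure_of_memLp (hp1 : 1 < p) (hp : p ≠ ∞)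
    (h1 : IsRidgeMultiplier S p (fun _ => 1)) {g : EuclideanSpace ℝ (Fin (n + 1)) → ℝ}
    (hg : MemLp g p (volume.restrict (lineTimesCube n))) :
    g ∈ lpClosure S p (volume.restrict (lineTimesCube n)) := by
  refine mem_lpClosure_of_approx hg fun ε hε => ?_
  obtain ⟨f, hfc, hfε, hf, -⟩ := hg.exists_hasCompactSupport_eLpNorm_sub_le hp hε
  exact ⟨f, h1.mem_lpClosure_of_hasCompactSupport hp1 hp hf hfc, hfε⟩

end IsRidgeMultiplier

end Multipliers

section Networks

theorem mem_shallowNetworks_of_mem_networkSpan {d : ℕ} {φ : ℝ → ℝ}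
    {F : EuclideanSpace ℝ (Fin d) → ℝ} (hF : F ∈ networkSpan (EuclideanSpace ℝ (Fin d)) φ) :
    F ∈ shallowNetworks d φ := by
  obtain ⟨k, t, g, rfl⟩ := Submodule.mem_span_set'.1 hF
  choose q hq using fun i => (g i).2
  refine ⟨k, fun i => (q i).1, t, fun i => (q i).2, ?_⟩
  ext x
  simp [← hq, neuron]

theorem isUniversalApproximator_of_lpClosure {d : ℕ} {φ : ℝ → ℝ}
    {Ω : Set (EuclideanSpace ℝ (Fin d))} {p : ℝ≥0∞} [Fact (1 ≤ p)]
    (h : ∀ g, MemLp g p (volume.restrict Ω) →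
      g ∈ lpClosure (networkSpan (EuclideanSpace ℝ (Fin d)) φ) p (volume.restrict Ω)) :
    IsUniversalApproximator φ Ω p := by
  refine Set.eq_univ_of_forall fun f => EMetric.mem_closure_iff.2 fun ε hε => ?_
  obtain ⟨-, hf⟩ := h f (Lp.memLp f)
  obtain ⟨δ, hδ0, hδ⟩ := exists_between hε
  obtain ⟨G, hG, hGm, hGδ⟩ := hf δ hδ0.ne'
  refine ⟨hGm.toLp G, ⟨G, mem_shallowNetworks_of_mem_networkSpan hG, hGm.coeFn_toLp⟩, ?_⟩
  rw [Lp.edist_def]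
  refine lt_of_le_of_lt (le_of_eq_of_le (eLpNorm_congr_ae ?_) hGδ) hδ
  exact EventuallyEq.rfl.sub hGm.coeFn_toLp

theorem EssentiallyOn.memLp_restrict_Icc {φ : ℝ → ℝ} (hmeas : NullMeasurable φ volume)
    (hbdd : EssentiallyOn IsBoundedOn φ Set.univ) (p : ℝ≥0∞) (c d : ℝ) :
    MemLp φ p (volume.restrict (Set.Icc c d)) := by
  obtain ⟨Z, hZ, C, hC⟩ := hbdd
  refine MemLp.of_bound hmeas.aemeasurable.aestronglyMeasurable.restrict C
    (ae_restrict_of_ae ?_)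
  filter_upwards [measure_eq_zero_iff_ae_notMem.1 hZ] with t ht using hC t ⟨trivial, ht⟩

theorem isRidgeMultiplier_one {n : ℕ} {φ : ℝ → ℝ} {p : ℝ≥0∞} [Fact (1 ≤ p)] {s : ℝ}
    (h : HasStepLimit φ p s) (hs : s ≠ 0) :
    IsRidgeMultiplier (networkSpan (EuclideanSpace ℝ (Fin (n + 1))) φ) p fun _ => 1 := by
  refine ⟨continuous_const, ⟨1, by simp⟩, fun f hf hfc v hv => ?_⟩
  simp only [mul_one]
  exact comp_mem_lpClosure (measurePreserving_inner hv)
    (fun G hG => comp_inner_mem_networkSpan hG v)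
    (mem_lpClosure_of_hasCompactSupport
      (fun c d hcd => h.indicator_Ioc_mem_lpClosure hs hcd) hf hfc)

end Networks

end ShallowNet

theorem theorem3p5_general (n : ℕ) (p : ℝ≥0∞) [Fact (1 ≤ p)] (hp1 : 1 < p) (hp : p < ∞)
    (φ : ℝ → ℝ) (hloc : ∀ R : ℝ, MemLp φ p (volume.restrict (Set.Icc (-R) R)))
    (hmono : ShallowNet.EventuallyEssentially ShallowNet.IsMonotoneOn φ)
    (a b : ℝ) (ha : ShallowNet.HasAELimit φ atTop a) (hb : ShallowNet.HasAELimit φ atBot b)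
    (hab : a ≠ b) :
    ShallowNet.IsUniversalApproximator φ (ShallowNet.lineTimesCube n) p := by
  have hstep : ShallowNet.HasStepLimit φ p (a - b) :=
    ShallowNet.hasStepLimit_of_eventuallyEssentially_isMonotoneOn hp.ne hloc hmono ha hb
  have hone := ShallowNet.isRidgeMultiplier_one (n := n) hstep (sub_ne_zero.2 hab)
  exact ShallowNet.isUniversalApproximator_of_lpClosure fun _ hg =>
    hone.mem_lpClosure_of_memLp hp1 hp.ne hg

/-- The hypothesis `NullMeasurable φ volume` says that `φ` is Lebesgue measurable, and
`Fact (1 ≤ p)`, which follows from `2 ≤ p`, only gives access to the norm on `L^p`. -/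
theorem theorem3p5 (n : ℕ) (p : ℝ≥0∞) [Fact (1 ≤ p)] (hp2 : 2 ≤ p) (hp : p < ∞)
    (φ : ℝ → ℝ) (hmeas : NullMeasurable φ (volume : Measure ℝ))
    (hbdd : ShallowNet.EssentiallyOn ShallowNet.IsBoundedOn φ Set.univ)
    (hmono : ShallowNet.EventuallyEssentially ShallowNet.IsMonotoneOn φ)
    (a b : ℝ) (ha : ShallowNet.HasAELimit φ atTop a) (hb : ShallowNet.HasAELimit φ atBot b)
    (hab : a ≠ b) :
    ShallowNet.IsUniversalApproximator φ (ShallowNet.lineTimesCube n) p :=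
  theorem3p5_general n p (ENNReal.one_lt_two.trans_le hp2) hp φ
    (fun _ => hbdd.memLp_restrict_Icc hmeas p _ _) hmono a b ha hb hab
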